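/- Call an element of an integral domain atomic if it is a product of one or more (not necessarily distinct) irreducible elements; in particular $0$ and the units are not atomic. An integral domain $D$ is almost atomic if for every nonzero nonunit $\alpha \in D$ there are irreducible elements $\pi_1, \dots, \pi_k \in D$ $(k \ge 1)$ such that $\alpha\pi_1\cdots\pi_k$ is atomic. It is semi-Furstenberg if there is an element $\beta \in D$ such that for every nonzero nonunit $\alpha \in D$ there is an irreducible $\pi \in D$ that divides $\alpha\beta$ but does not divide $\beta$. Let $R_0 = \mathbb{F}_2[y_0^{\alpha} : \alpha \in \mathbb{Q}_{\ge 0}]$. For $n \ge 0$, let $\Gamma_n$ be the set of elements of $R_n$ that are not atomic in $R_n$, and let $$R_{n+1} = R_n\left[z_{\gamma},\ \frac{x_{n+1}\gamma}{z_{\gamma}},\ y_{n+1}^{\alpha} \ :\ \gamma \in \Gamma_n,\ \alpha \in \mathbb{Q}_{\ge 0}\right],$$ where $x_{n+1}$, $y_{n+1}$ and the $z_\gamma$ $(\gamma \in \Gamma_n)$ are new independent indeterminates over $R_n$ at each step; that is, $R_{n+1}$ is the $R_n$-subalgebra generated by the displayed elements in the ring $R_n\left[z_\gamma^{\pm 1}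 : \gamma \in \Gamma_n\right][x_{n+1}]\left[y_{n+1}^{\alpha} : \alpha \in \mathbb{Q}_{\ge 0}\right]$. Let $D = \bigcup_{n \ge 0} R_n$. Then $D$ is an integral domain that is almost atomic but not semi-Furstenberg. -/

import Mathlib

open scoped NNRat

namespace SubatomicTower

/-- An element of a commutative ring is atomic if it is a product of one or more (not necessarily
distinct) irreducible elements. In particular `0` and the units of a domain are not atomic. -/
def IsAtomicElement {R : Type*} [CommRing R] (a : R) : Prop :=
  ∃ s : Multiset R, s ≠ 0 ∧ (∀ π ∈ s, Irreducible π) ∧ s.prod = a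

/-- For every nonzero nonunit `α` there are irreducible elements `π₁, …, πₖ` such that
`α * π₁ * ⋯ * πₖ` is a product of irreducible elements. -/
def IsAlmostAtomic (R : Type*) [CommRing R] : Prop :=
  ∀ α : R, α ≠ 0 → ¬ IsUnit α →
    ∃ s : Multiset R, s ≠ 0 ∧ (∀ π ∈ s, Irreducible π) ∧ IsAtomicElement (α * s.prod)

/-- There is a single `β` such that for every nonzero nonunit `α` some irreducible element
divides `α * β` but not `β`. -/
def IsSemiFurstenberg (R : Type*) [CommRing R] : Prop :=
  ∃ β : R, ∀ α : R, α ≠ 0 → ¬ IsUnit α →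
    ∃ π : R, Irreducible π ∧ π ∣ α * β ∧ ¬ π ∣ β

/-- The set `Γ` of elements of `R` that are not atomic in `R`, as a type. -/
abbrev NonAtomic (R : Type*) [CommRing R] : Type _ :=
  {γ : R // ¬ IsAtomicElement γ}

/-- The ring `R[z_γ, z_γ⁻¹ (γ ∈ Γ)][x][y ^ α (α ∈ ℚ, α ≥ 0)]` in new indeterminates
`z_γ`, `x`, `y`: a monomial is given by the exponents of the `z_γ` (integers, almost all zero),
the exponent of `x` (a natural number) and that of `y` (a nonnegative rational). -/
abbrev Ambient (R : Type*) [CommRing R] : Type _ :=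
  AddMonoidAlgebra R ((NonAtomic R →₀ ℤ) × ℕ × ℚ≥0)

/-- The indeterminate `z_γ`. -/
noncomputable def zVar {R : Type*} [CommRing R] (γ : NonAtomic R) : Ambient R :=
  AddMonoidAlgebra.single (Finsupp.single γ 1, 0, 0) 1

/-- The element `x * γ / z_γ`. -/
noncomputable def xQuot {R : Type*} [CommRing R] (γ : NonAtomic R) : Ambient R :=
  AddMonoidAlgebra.single (Finsupp.single γ (-1), 1, 0) (γ : R)

/-- The rational power `y ^ α`. -/
noncomputable def yPow {R : Type*} [CommRing R] (α : ℚ≥0) : Ambient R :=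
  AddMonoidAlgebra.single (0, 0, α) 1

/-- The ring `R[z_γ][x * γ / z_γ][y ^ α]`, where `γ` runs over the non-atomic elements of `R`
and `α` over the nonnegative rationals. -/
noncomputable def nextRing (R : Type*) [CommRing R] : Subalgebra R (Ambient R) :=
  Algebra.adjoin R (Set.range zVar ∪ Set.range xQuot ∪ Set.range yPow)

/-- The rings `R₀ = 𝔽₂[y₀ ^ α]` and `Rₙ₊₁ = Rₙ[z_γ][xₙ₊₁ * γ / z_γ][yₙ₊₁ ^ α]`. -/
noncomputable def stage : ℕ → CommRingCat.{0}
  | 0 => CommRingCat.of (AddMonoidAlgebra (ZMod 2) ℚ≥0)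
  | n + 1 => CommRingCat.of (nextRing (stage n))

/-- The inclusion of `Rₙ` in `Rₙ₊₁` as the constants. -/
noncomputable def stageSucc (n : ℕ) : stage n →+* stage (n + 1) :=
  algebraMap (stage n) (nextRing (stage n))

/-- The inclusion of `Rᵢ` in `Rⱼ` for `i ≤ j`. -/
noncomputable def stageMap (i j : ℕ) (h : i ≤ j) : stage i →+* stage j :=
  Nat.leRec (motive := fun k _ => stage i →+* stage k) (RingHom.id (stage i))
    (fun k _ f => (stageSucc k).comp f) h

/-- The union `D` of the increasing sequence `R₀ ⊆ R₁ ⊆ ⋯`, formed as the direct limit along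
the inclusions. -/
abbrev D : Type :=
  Ring.DirectLimit (fun n => stage n) (fun i j h => stageMap i j h)

end SubatomicTower

/-!
Each inclusion `R → nextRing R` has a divisor-closed image: every divisor of a nonzero element of
`R` already lies in `R` (`isDivisorClosed_algebraMap_nextRing`). Hence the maps `stage n → D` are
injective with divisor-closed image (`isDivisorClosed_toD`), and an element of a stage is a unit, or
irreducible, in the stage if and only if it is so in `D`.

All facts about `nextRing R` come from the monomial grading of the ambient monoid algebra.
As the exponent monoid has the two-unique-sums property, over a domain the factors of a monomial
are monomials (`exists_eq_single_of_mul_eq_single`). On the other hand, `IsAdmissible` restricts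
the monomials that occur in `nextRing R`: in `x`-degree `0` the exponents of the `z_γ` are
nonnegative, and in `x`-degree `1` a negative exponent can only be a single `-1`, at some `γ` that
divides the coefficient. Therefore `z_γ` and `x * γ / z_γ` are irreducible.

*Almost atomic.* If `γ` is a nonzero non-atomic element of a stage, then in the next stage
`γ * (z_1 * (x / z_1)) = γ * x = z_γ * (x * γ / z_γ)`, where `z_1`, `x / z_1`, `z_γ` and
`x * γ / z_γ` are irreducible.

*Not semi-Furstenberg.* Let `β` be an element of a stage and `y` the variable of the next stage with
rational exponents. A divisor of `y * β` is of the form `r * y ^ a`, and it is reducible if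
`a > 0`, since `y ^ a = y ^ (a / 2) * y ^ (a / 2)`. So an irreducible divisor of `y * β` is a
constant and divides `β`.
-/

namespace SubatomicTower

/-! ### Divisor-closed ring homomorphisms -/

/-- A ring homomorphism is divisor-closed if it is injective and its image contains all divisors
of the images of nonzero elements. -/
structure IsDivisorClosed {A B : Type*} [CommRing A] [CommRing B] (φ : A →+* B) : Prop where
  injective : Function.Injective φ
  mem_range_of_dvd : ∀ {c : A} {b : B}, c ≠ 0 → b ∣ φ c → ∃ a, φ a = b

namespace IsDivisorClosed

variable {A B C : Type*} [CommRing A] [CommRing B] [CommRing C] {φ : A →+* B} {ψ : B →+* C}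

lemma id : IsDivisorClosed (RingHom.id A) :=
  ⟨Function.injective_id, fun _ _ => ⟨_, rfl⟩⟩

lemma exists_of_mul_eq (hφ : IsDivisorClosed φ) {c : A} (hc : c ≠ 0) {x y : B}
    (h : x * y = φ c) : ∃ a b, φ a = x ∧ φ b = y ∧ a * b = c := by
  obtain ⟨a, rfl⟩ := hφ.mem_range_of_dvd hc (Dvd.intro _ h)
  obtain ⟨b, rfl⟩ := hφ.mem_range_of_dvd hc (Dvd.intro_left _ h)
  exact ⟨a, b, rfl, rfl, hφ.injective (by rw [map_mul, h])⟩

lemma comp (hψ : IsDivisorClosed ψ) (hφ : IsDivisorClosed φ) : IsDivisorClosed (ψ.comp φ) where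
  injective := hψ.injective.comp hφ.injective
  mem_range_of_dvd := by
    rintro c b hc ⟨x, hx⟩
    obtain ⟨b, x, rfl, rfl, h⟩ :=
      hψ.exists_of_mul_eq ((map_ne_zero_iff φ hφ.injective).2 hc) hx.symm
    obtain ⟨a, rfl⟩ := hφ.mem_range_of_dvd hc (Dvd.intro _ h)
    exact ⟨a, rfl⟩

lemma isUnit_map_iff [Nontrivial A] (hφ : IsDivisorClosed φ) {a : A} :
    IsUnit (φ a) ↔ IsUnit a := by
  refine ⟨fun h => ?_, fun h => h.map φ⟩
  obtain ⟨y, hy⟩ := h.exists_right_inv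
  obtain ⟨a', b', ha, -, hab⟩ := hφ.exists_of_mul_eq one_ne_zero (hy.trans (map_one φ).symm)
  rw [← hφ.injective ha]
  exact IsUnit.of_mul_eq_one _ hab

lemma irreducible_map_iff [IsDomain A] (hφ : IsDivisorClosed φ) {a : A} :
    Irreducible (φ a) ↔ Irreducible a := by
  constructor
  · refine fun h => ⟨fun hu => h.not_isUnit (hφ.isUnit_map_iff.2 hu), fun x y hxy => ?_⟩
    exact (h.isUnit_or_isUnit (by rw [hxy, map_mul] : φ a = φ x * φ y)).imp
      hφ.isUnit_map_iff.1 hφ.isUnit_map_iff.1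
  · refine fun h => ⟨fun hu => h.not_isUnit (hφ.isUnit_map_iff.1 hu), fun x y hxy => ?_⟩
    obtain ⟨x, y, rfl, rfl, hxy'⟩ := hφ.exists_of_mul_eq h.ne_zero hxy.symm
    exact (h.isUnit_or_isUnit hxy'.symm).imp hφ.isUnit_map_iff.2 hφ.isUnit_map_iff.2

lemma isAtomicElement_map [IsDomain A] (hφ : IsDivisorClosed φ) {a : A}
    (ha : IsAtomicElement a) : IsAtomicElement (φ a) := by
  obtain ⟨s, hs, hirr, rfl⟩ := ha
  refine ⟨s.map φ, by simpa using hs, fun π hπ => ?_, Multiset.prod_hom s φ⟩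
  obtain ⟨p, hp, rfl⟩ := Multiset.mem_map.1 hπ
  exact hφ.irreducible_map_iff.2 (hirr p hp)

end IsDivisorClosed

lemma isAtomicElement_mul_of_irreducible {R : Type*} [CommRing R] {p q : R} (hp : Irreducible p)
    (hq : Irreducible q) : IsAtomicElement (p * q) :=
  ⟨{p, q}, by simp, by simp [hp, hq], by simp⟩

/-! ### Factors of monomials -/

/-- Factors of a nonzero monomial are monomials: if one of the two supports had more than one
element, there would be two unique sums of exponents, and the product would have at least two
terms. -/
lemma exists_eq_single_of_mul_eq_single {R M : Type*} [CommRing R] [IsDomain R] [AddCommMonoid M]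
    [TwoUniqueSums M] {f g : AddMonoidAlgebra R M} {m : M} {r : R} (hr : r ≠ 0)
    (h : f * g = AddMonoidAlgebra.single m r) :
    ∃ a b s t, f = AddMonoidAlgebra.single a s ∧ g = AddMonoidAlgebra.single b t ∧
      a + b = m ∧ s * t = r := by
  classical
  have hne : f * g ≠ 0 := by rw [h]; simpa using hr
  have hf : f ≠ 0 := left_ne_zero_of_mul hne
  have hg : g ≠ 0 := right_ne_zero_of_mul hne
  have hcard : ¬ 1 < f.coeff.support.card * g.coeff.support.card := by
    intro hlt
    obtain ⟨p, hp, q, hq, hpq, hup, huq⟩ := TwoUniqueSums.uniqueAdd_of_one_lt_card hlt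
    rw [Finset.mem_product] at hp hq
    have key : ∀ p : M × M, p.1 ∈ f.coeff.support → p.2 ∈ g.coeff.support →
        UniqueAdd f.coeff.support g.coeff.support p.1 p.2 → p.1 + p.2 = m := by
      intro p h1 h2 hu
      have h3 := AddMonoidAlgebra.coeff_mul_add_of_uniqueAdd hu
      rw [h, AddMonoidAlgebra.coeff_single] at h3
      by_contra hne
      rw [Finsupp.single_eq_of_ne hne] at h3
      exact mul_ne_zero (Finsupp.mem_support_iff.1 h1) (Finsupp.mem_support_iff.1 h2) h3.symm
    have heq := (key p hp.1 hp.2 hup).trans (key q hq.1 hq.2 huq).symm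
    have := huq hp.1 hp.2 heq
    exact hpq (Prod.ext this.1 this.2)
  have hfc : 0 < f.coeff.support.card :=
    Finset.card_pos.2 (Finsupp.support_nonempty_iff.2 (by simpa using hf))
  have hgc : 0 < g.coeff.support.card :=
    Finset.card_pos.2 (Finsupp.support_nonempty_iff.2 (by simpa using hg))
  have hf1 : f.coeff.support.card ≤ 1 := by nlinarith
  have hg1 : g.coeff.support.card ≤ 1 := by nlinarith
  obtain ⟨a, s, hs⟩ : ∃ a s, f.coeff = Finsupp.single a s :=
    ⟨_, _, (Finsupp.card_support_eq_one.1 (le_antisymm hf1 hfc)).choose_spec.2⟩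
  obtain ⟨b, t, ht⟩ : ∃ b t, g.coeff = Finsupp.single b t :=
    ⟨_, _, (Finsupp.card_support_eq_one.1 (le_antisymm hg1 hgc)).choose_spec.2⟩
  replace hs : f = AddMonoidAlgebra.single a s := AddMonoidAlgebra.coeff_injective hs
  replace ht : g = AddMonoidAlgebra.single b t := AddMonoidAlgebra.coeff_injective ht
  refine ⟨a, b, s, t, hs, ht, ?_⟩
  rw [hs, ht, AddMonoidAlgebra.single_mul_single, ← AddMonoidAlgebra.coeff_inj] at h
  simp only [AddMonoidAlgebra.coeff_single] at h
  rcases (Finsupp.single_eq_single_iff _ _ _ _).1 h with h | h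
  · exact h
  · exact absurd h.2 hr

/-! ### Monomials of `nextRing R` -/

section NextRing

variable {R : Type*} [CommRing R]

/-- The conditions on a nonzero coefficient `r` of the monomial with exponents `m` in an element
of `nextRing R`, for the monomials of degree `0` or `1` in `x`. -/
def IsAdmissible (m : (NonAtomic R →₀ ℤ) × ℕ × ℚ≥0) (r : R) : Prop :=
  r = 0 ∨ ((m.2.1 = 0 → ∀ γ, 0 ≤ m.1 γ) ∧
    (m.2.1 = 1 → ∀ γ, m.1 γ < 0 → -1 ≤ m.1 γ ∧ (∀ δ ≠ γ, 0 ≤ m.1 δ) ∧ (γ : R) ∣ r))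

namespace IsAdmissible

variable {m n : (NonAtomic R →₀ ℤ) × ℕ × ℚ≥0} {r s : R}

lemma zero : IsAdmissible m 0 := Or.inl rfl

lemma add (hr : IsAdmissible m r) (hs : IsAdmissible m s) : IsAdmissible m (r + s) := by
  rcases hr with rfl | hr
  · rwa [zero_add]
  rcases hs with rfl | hs
  · rw [add_zero]; exact Or.inr hr
  · exact Or.inr ⟨hr.1, fun h γ hγ => ⟨(hr.2 h γ hγ).1, (hr.2 h γ hγ).2.1,
      dvd_add (hr.2 h γ hγ).2.2 (hs.2 h γ hγ).2.2⟩⟩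

lemma mul (hr : IsAdmissible m r) (hs : IsAdmissible n s) : IsAdmissible (m + n) (r * s) := by
  rcases hr with rfl | hr
  · rw [zero_mul]; exact zero
  rcases hs with rfl | hs
  · rw [mul_zero]; exact zero
  refine Or.inr ⟨fun h γ => ?_, fun h γ hγ => ?_⟩
  · simp only [Prod.snd_add, Prod.fst_add, Finsupp.add_apply] at h ⊢
    exact add_nonneg (hr.1 (by lia) γ) (hs.1 (by lia) γ)
  · simp only [Prod.snd_add, Prod.fst_add, Finsupp.add_apply] at h hγ ⊢
    -- One of the two monomials has degree `0` in `x`, hence nonnegative exponents.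
    obtain ⟨h0, h1⟩ | ⟨h0, h1⟩ : m.2.1 = 0 ∧ n.2.1 = 1 ∨ n.2.1 = 0 ∧ m.2.1 = 1 := by lia
    · have hm := hr.1 h0
      obtain ⟨h2, h3, h4⟩ := hs.2 h1 γ (by have := hm γ; lia)
      exact ⟨by have := hm γ; lia, fun δ hδ => add_nonneg (hm δ) (h3 δ hδ), h4.mul_left _⟩
    · have hn := hs.1 h0
      obtain ⟨h2, h3, h4⟩ := hr.2 h1 γ (by have := hn γ; lia)
      exact ⟨by have := hn γ; lia, fun δ hδ => add_nonneg (h3 δ hδ) (hn δ), h4.mul_right _⟩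

end IsAdmissible

lemma isAdmissible_coeff_single {m : (NonAtomic R →₀ ℤ) × ℕ × ℚ≥0} {r : R}
    (h : IsAdmissible m r) (n : (NonAtomic R →₀ ℤ) × ℕ × ℚ≥0) :
    IsAdmissible n ((AddMonoidAlgebra.single m r : Ambient R).coeff n) := by
  classical
  rw [AddMonoidAlgebra.coeff_single, Finsupp.single_apply]
  split_ifs with hmn
  · exact hmn ▸ h
  · exact IsAdmissible.zero

lemma isAdmissible_coeff_of_mem_nextRing {f : Ambient R} (hf : f ∈ nextRing R) :
    ∀ m, IsAdmissible m (f.coeff m) := by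
  classical
  induction hf using Algebra.adjoin_induction with
  | mem f hf =>
    rcases hf with (⟨γ, rfl⟩ | ⟨γ, rfl⟩) | ⟨α, rfl⟩
    · refine isAdmissible_coeff_single (Or.inr ⟨fun _ δ => ?_, by simp⟩)
      simp only [Finsupp.single_apply]; split_ifs <;> simp
    · refine isAdmissible_coeff_single (Or.inr ⟨by simp, fun _ δ hδ => ?_⟩)
      simp only [Finsupp.single_apply] at hδ ⊢
      split_ifs at hδ with h
      · subst h
        refine ⟨by simp, fun δ hδ => ?_, dvd_rfl⟩
        rw [if_neg hδ.symm]
      · simp at hδ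
    · exact isAdmissible_coeff_single (Or.inr ⟨by simp, by simp⟩)
  | algebraMap r =>
    rw [AddMonoidAlgebra.coe_algebraMap]
    exact isAdmissible_coeff_single (Or.inr ⟨by simp, by simp⟩)
  | add f g _ _ hf hg => exact fun m => (hf m).add (hg m)
  | mul f g _ _ hf hg =>
    intro m
    rw [AddMonoidAlgebra.coeff_mul]
    refine Finset.sum_induction _ _ (fun _ _ => IsAdmissible.add) IsAdmissible.zero fun a _ => ?_
    refine Finset.sum_induction _ _ (fun _ _ => IsAdmissible.add) IsAdmissible.zero fun b _ => ?_
    dsimp only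
    split_ifs with hab
    · exact hab ▸ (hf a).mul (hg b)
    · exact IsAdmissible.zero

lemma coe_algebraMap_nextRing (r : R) :
    ((algebraMap R (nextRing R) r : nextRing R) : Ambient R) = AddMonoidAlgebra.single 0 r := by
  rw [Subalgebra.coe_algebraMap, AddMonoidAlgebra.coe_algebraMap]; rfl

lemma isUnit_of_coe_eq_single_zero {f : nextRing R} {s : R} (hs : IsUnit s)
    (hf : (f : Ambient R) = AddMonoidAlgebra.single 0 s) : IsUnit f := by
  have : f = algebraMap R (nextRing R) s := Subtype.ext (by rw [hf, coe_algebraMap_nextRing])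
  rw [this]
  exact hs.map _

/-- `z_γ` as an element of `nextRing R`. -/
noncomputable def zElt (γ : NonAtomic R) : nextRing R :=
  ⟨zVar γ, Algebra.subset_adjoin (Or.inl (Or.inl ⟨γ, rfl⟩))⟩

/-- `x * γ / z_γ` as an element of `nextRing R`. -/
noncomputable def xElt (γ : NonAtomic R) : nextRing R :=
  ⟨xQuot γ, Algebra.subset_adjoin (Or.inl (Or.inr ⟨γ, rfl⟩))⟩

/-- `y ^ α` as an element of `nextRing R`. -/
noncomputable def yElt (α : ℚ≥0) : nextRing R :=
  ⟨yPow α, Algebra.subset_adjoin (Or.inr ⟨α, rfl⟩)⟩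

/-- The product of `z_γ` and `x * γ / z_γ` is `γ * x`, and `x` does not depend on `γ`. -/
lemma coe_zElt_mul_xElt (γ : NonAtomic R) :
    ((zElt γ * xElt γ : nextRing R) : Ambient R) = AddMonoidAlgebra.single (0, 1, 0) (γ : R) := by
  change zVar γ * xQuot γ = _
  rw [zVar, xQuot, AddMonoidAlgebra.single_mul_single]
  simp

variable [IsDomain R]

/-- In `nextRing R` the factors of a nonzero monomial are monomials with admissible
coefficients. -/
lemma exists_eq_single_of_mul_eq_single_nextRing {f g : nextRing R}
    {m : (NonAtomic R →₀ ℤ) × ℕ × ℚ≥0} {r : R} (hr : r ≠ 0)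
    (h : ((f * g : nextRing R) : Ambient R) = AddMonoidAlgebra.single m r) :
    ∃ a b s t, (f : Ambient R) = AddMonoidAlgebra.single a s ∧
      (g : Ambient R) = AddMonoidAlgebra.single b t ∧ a + b = m ∧ s * t = r ∧
      IsAdmissible a s ∧ IsAdmissible b t := by
  obtain ⟨a, b, s, t, hf, hg, hm, hst⟩ := exists_eq_single_of_mul_eq_single hr h
  refine ⟨a, b, s, t, hf, hg, hm, hst, ?_, ?_⟩
  · simpa [hf] using isAdmissible_coeff_of_mem_nextRing f.2 a
  · simpa [hg] using isAdmissible_coeff_of_mem_nextRing g.2 b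

lemma isDivisorClosed_algebraMap_nextRing : IsDivisorClosed (algebraMap R (nextRing R)) where
  injective := fun a b h => by
    have h := congrArg (Subtype.val) h
    rw [coe_algebraMap_nextRing, coe_algebraMap_nextRing] at h
    exact Finsupp.single_injective _ (AddMonoidAlgebra.coeff_inj.2 h)
  mem_range_of_dvd := by
    rintro c f hc ⟨g, hfg⟩
    obtain ⟨a, b, s, t, hf, hg, hab, hst, ha, hb⟩ :=
      exists_eq_single_of_mul_eq_single_nextRing hc (by rw [← hfg, coe_algebraMap_nextRing])
    have hs : s ≠ 0 := by rintro rfl; exact hc (by rw [← hst, zero_mul])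
    have ht : t ≠ 0 := by rintro rfl; exact hc (by rw [← hst, mul_zero])
    have h1 : a.1 + b.1 = 0 := congrArg Prod.fst hab
    have h2 : a.2.1 + b.2.1 = 0 := congrArg (fun p => p.2.1) hab
    have h3 : a.2.2 + b.2.2 = 0 := congrArg (fun p => p.2.2) hab
    have ha1 := (ha.resolve_left hs).1 (by lia)
    have hb1 := (hb.resolve_left ht).1 (by lia)
    have ha0 : a = 0 := by
      refine Prod.ext ?_ (Prod.ext (by simp; lia) (add_eq_zero.1 h3).1)
      ext γ
      have := DFunLike.congr_fun h1 γ
      simp only [Finsupp.add_apply, Finsupp.zero_apply] at this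
      have := ha1 γ
      have := hb1 γ
      simp; lia
    exact ⟨s, Subtype.ext (by rw [coe_algebraMap_nextRing, hf, ha0])⟩

/-- A unit of `nextRing R` is a constant, since it divides `1`. -/
lemma not_isUnit_of_coe_eq_single {f : nextRing R} {m : (NonAtomic R →₀ ℤ) × ℕ × ℚ≥0} {s : R}
    (hm : m ≠ 0) (hs : s ≠ 0) (hf : (f : Ambient R) = AddMonoidAlgebra.single m s) :
    ¬ IsUnit f := by
  intro hu
  obtain ⟨c, rfl⟩ := isDivisorClosed_algebraMap_nextRing.mem_range_of_dvd (b := f)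
    (one_ne_zero (α := R)) hu.dvd
  rw [coe_algebraMap_nextRing, ← AddMonoidAlgebra.coeff_inj] at hf
  simp only [AddMonoidAlgebra.coeff_single] at hf
  rcases (Finsupp.single_eq_single_iff _ _ _ _).1 hf with h | h
  · exact hm h.1.symm
  · exact hs h.2

/-! ### Irreducible elements of `nextRing R` -/

lemma irreducible_zElt (γ : NonAtomic R) : Irreducible (zElt γ) := by
  classical
  refine ⟨not_isUnit_of_coe_eq_single (m := (Finsupp.single γ 1, 0, 0)) (s := 1)
    (fun h => ?_) one_ne_zero rfl, fun f g hfg => ?_⟩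
  · have h := DFunLike.congr_fun (congrArg Prod.fst h) γ
    simp at h
  obtain ⟨a, b, s, t, hf, hg, hab, hst, ha, hb⟩ := exists_eq_single_of_mul_eq_single_nextRing
    (m := (Finsupp.single γ 1, 0, 0)) one_ne_zero (by rw [← hfg]; rfl)
  have hs : s ≠ 0 := by rintro rfl; simp at hst
  have ht : t ≠ 0 := by rintro rfl; simp at hst
  have h1 : ∀ δ, a.1 δ + b.1 δ = Finsupp.single γ 1 δ := fun δ => by
    rw [← Finsupp.add_apply]; exact DFunLike.congr_fun (congrArg Prod.fst hab) δ
  have h2 : a.2.1 + b.2.1 = 0 := congrArg (fun p => p.2.1) hab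
  have h3 : a.2.2 + b.2.2 = 0 := congrArg (fun p => p.2.2) hab
  have ha1 := (ha.resolve_left hs).1 (by lia)
  have hb1 := (hb.resolve_left ht).1 (by lia)
  have hne : ∀ δ, δ ≠ γ → a.1 δ = 0 ∧ b.1 δ = 0 := fun δ hδ => by
    have := h1 δ
    rw [Finsupp.single_eq_of_ne hδ] at this
    have := ha1 δ
    have := hb1 δ
    lia
  have heq := h1 γ
  rw [Finsupp.single_eq_same] at heq
  have h4 := ha1 γ
  have h5 := hb1 γ
  obtain h6 | h6 : a.1 γ = 0 ∨ b.1 γ = 0 := by lia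
  · left
    refine isUnit_of_coe_eq_single_zero (IsUnit.of_mul_eq_one _ hst) (hf.trans ?_)
    congr 1
    refine Prod.ext ?_ (Prod.ext (by simp; lia) (add_eq_zero.1 h3).1)
    ext δ
    by_cases hδ : δ = γ
    · rw [hδ, h6]; rfl
    · rw [(hne δ hδ).1]; rfl
  · right
    refine isUnit_of_coe_eq_single_zero (IsUnit.of_mul_eq_one_right _ hst) (hg.trans ?_)
    congr 1
    refine Prod.ext ?_ (Prod.ext (by simp; lia) (add_eq_zero.1 h3).2)
    ext δ
    by_cases hδ : δ = γ
    · rw [hδ, h6]; rfl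
    · rw [(hne δ hδ).2]; rfl

/-- If a factor of `x * γ / z_γ` in `nextRing R` has degree `0` in `x`, then it is a unit: its
cofactor must contain `z_γ⁻¹`, hence has a coefficient that is a multiple of `γ`. -/
lemma isUnit_of_mul_eq_xElt {γ : NonAtomic R} (hγ : (γ : R) ≠ 0) {g : nextRing R}
    {a b : (NonAtomic R →₀ ℤ) × ℕ × ℚ≥0} {s t : R}
    (hg : (g : Ambient R) = AddMonoidAlgebra.single b t)
    (hab : a + b = (Finsupp.single γ (-1), 1, 0)) (hst : s * t = γ)
    (ha : IsAdmissible a s) (hb : IsAdmissible b t) (hb0 : b.2.1 = 0) : IsUnit g := by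
  have hs : s ≠ 0 := by rintro rfl; exact hγ (by rw [← hst, zero_mul])
  have ht : t ≠ 0 := by rintro rfl; exact hγ (by rw [← hst, mul_zero])
  have h1 : ∀ δ, a.1 δ + b.1 δ = Finsupp.single γ (-1) δ := fun δ => by
    rw [← Finsupp.add_apply]; exact DFunLike.congr_fun (congrArg Prod.fst hab) δ
  have h2 : a.2.1 + b.2.1 = 1 := congrArg (fun p => p.2.1) hab
  have h3 : a.2.2 + b.2.2 = 0 := congrArg (fun p => p.2.2) hab
  have hb1 := (hb.resolve_left ht).1 hb0
  have heq := h1 γ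
  rw [Finsupp.single_eq_same] at heq
  have h4 := hb1 γ
  obtain ⟨h5, h6, u, rfl⟩ := (ha.resolve_left hs).2 (by lia) γ (by lia)
  have hut : u * t = 1 := mul_left_cancel₀ hγ (by rw [← mul_assoc, hst, mul_one])
  refine isUnit_of_coe_eq_single_zero (IsUnit.of_mul_eq_one_right _ hut) (hg.trans ?_)
  congr 1
  refine Prod.ext ?_ (Prod.ext hb0 (add_eq_zero.1 h3).2)
  ext δ
  change b.1 δ = 0
  by_cases hδ : δ = γ
  · rw [hδ]; lia
  · have := h1 δ
    rw [Finsupp.single_eq_of_ne hδ] at this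
    have := h6 δ hδ
    have := hb1 δ
    lia

lemma irreducible_xElt {γ : NonAtomic R} (hγ : (γ : R) ≠ 0) : Irreducible (xElt γ) := by
  refine ⟨not_isUnit_of_coe_eq_single (m := (Finsupp.single γ (-1), 1, 0)) (s := γ)
    (fun h => ?_) hγ rfl, fun f g hfg => ?_⟩
  · exact absurd (congrArg (fun p => p.2.1) h : (1 : ℕ) = 0) one_ne_zero
  obtain ⟨a, b, s, t, hf, hg, hab, hst, ha, hb⟩ := exists_eq_single_of_mul_eq_single_nextRing
    (m := (Finsupp.single γ (-1), 1, 0)) hγ (by rw [← hfg]; rfl)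
  have h2 : a.2.1 + b.2.1 = 1 := congrArg (fun p => p.2.1) hab
  obtain h0 | h0 : a.2.1 = 0 ∨ b.2.1 = 0 := by lia
  · exact Or.inl (isUnit_of_mul_eq_xElt hγ hf (by rw [add_comm, hab]) (by rw [mul_comm, hst])
      hb ha h0)
  · exact Or.inr (isUnit_of_mul_eq_xElt hγ hg hab hst ha hb h0)

/-- Every nonzero non-atomic `γ` becomes a product of irreducible elements after multiplication by
`z_1` and `x / z_1`. The element `1` is itself non-atomic, so that these are available. -/
lemma exists_isAtomicElement_mul_nextRing {γ : R} (hγ : γ ≠ 0) (hna : ¬ IsAtomicElement γ) :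
    ∃ p q : nextRing R, Irreducible p ∧ Irreducible q ∧
      IsAtomicElement (algebraMap R (nextRing R) γ * (p * q)) := by
  have h1 : ¬ IsAtomicElement (1 : R) := by
    rintro ⟨s, hs, hirr, hprod⟩
    obtain ⟨p, hp⟩ := Multiset.exists_mem_of_ne_zero hs
    exact (hirr p hp).not_isUnit (isUnit_of_dvd_one (hprod ▸ Multiset.dvd_prod hp))
  refine ⟨zElt ⟨1, h1⟩, xElt ⟨1, h1⟩, irreducible_zElt _, irreducible_xElt one_ne_zero, ?_⟩
  have : algebraMap R (nextRing R) γ * (zElt ⟨1, h1⟩ * xElt ⟨1, h1⟩) =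
      zElt ⟨γ, hna⟩ * xElt ⟨γ, hna⟩ := by
    apply Subtype.ext
    rw [Subalgebra.coe_mul (nextRing R) (algebraMap R (nextRing R) γ), coe_zElt_mul_xElt,
      coe_zElt_mul_xElt, coe_algebraMap_nextRing, AddMonoidAlgebra.single_mul_single]
    simp
  rw [this]
  exact isAtomicElement_mul_of_irreducible (irreducible_zElt _) (irreducible_xElt hγ)

lemma not_isUnit_yElt {α : ℚ≥0} (hα : α ≠ 0) : ¬ IsUnit (yElt α : nextRing R) :=
  not_isUnit_of_coe_eq_single (m := (0, 0, α)) (s := 1) (by simpa using hα) one_ne_zero rfl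

lemma yElt_ne_zero (α : ℚ≥0) : (yElt α : nextRing R) ≠ 0 := by
  intro h
  have h : yPow α = (0 : Ambient R) := congrArg Subtype.val h
  simp [yPow] at h

/-- An irreducible divisor of `y * β` divides `β`: it is `r * y ^ a` for a divisor `r` of `β`,
and `a = 0`, since otherwise `r * y ^ (a / 2)` and `y ^ (a / 2)` are nonunits. -/
lemma dvd_of_dvd_yElt_mul {β : R} (hβ : β ≠ 0) {π : nextRing R} (hπ : Irreducible π)
    (hdvd : π ∣ yElt 1 * algebraMap R (nextRing R) β) : π ∣ algebraMap R (nextRing R) β := by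
  obtain ⟨g, hg⟩ := hdvd
  obtain ⟨a, b, s, t, hf, hg, hab, hst, ha, hb⟩ := exists_eq_single_of_mul_eq_single_nextRing
    (f := π) (g := g) (m := (0, 0, 1)) hβ (by
      rw [← hg, Subalgebra.coe_mul, coe_algebraMap_nextRing]
      change yPow 1 * _ = _
      rw [yPow, AddMonoidAlgebra.single_mul_single]
      simp)
  have hs : s ≠ 0 := by rintro rfl; exact hβ (by rw [← hst, zero_mul])
  have ht : t ≠ 0 := by rintro rfl; exact hβ (by rw [← hst, mul_zero])
  have h1 : ∀ δ, a.1 δ + b.1 δ = 0 := fun δ => by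
    rw [← Finsupp.add_apply]; exact DFunLike.congr_fun (congrArg Prod.fst hab) δ
  have h2 : a.2.1 + b.2.1 = 0 := congrArg (fun p => p.2.1) hab
  have ha1 := (ha.resolve_left hs).1 (by lia)
  have hb1 := (hb.resolve_left ht).1 (by lia)
  have ha0 : a = (0, 0, a.2.2) := by
    refine Prod.ext ?_ (Prod.ext (by simp; lia) rfl)
    ext δ
    have := h1 δ
    have := ha1 δ
    have := hb1 δ
    simp; lia
  by_cases hα : a.2.2 = 0
  · refine ⟨algebraMap R (nextRing R) t, ?_⟩
    have : π = algebraMap R (nextRing R) s := Subtype.ext (by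
      rw [hf, ha0, hα, coe_algebraMap_nextRing]; rfl)
    rw [this, ← map_mul, hst]
  · exfalso
    have hhalf : a.2.2 / 2 ≠ 0 := div_ne_zero hα two_ne_zero
    have hcoe : ((algebraMap R (nextRing R) s * yElt (a.2.2 / 2) : nextRing R) : Ambient R) =
        AddMonoidAlgebra.single (0, 0, a.2.2 / 2) s := by
      rw [Subalgebra.coe_mul, coe_algebraMap_nextRing]
      change _ * yPow _ = _
      rw [yPow, AddMonoidAlgebra.single_mul_single]
      simp
    have hfac : π = algebraMap R (nextRing R) s * yElt (a.2.2 / 2) * yElt (a.2.2 / 2) := by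
      apply Subtype.ext
      rw [Subalgebra.coe_mul, hcoe, hf]
      change _ = _ * yPow _
      rw [yPow, AddMonoidAlgebra.single_mul_single]
      conv_lhs => rw [ha0]
      simp
    rcases hπ.isUnit_or_isUnit hfac with h | h
    · exact not_isUnit_of_coe_eq_single (by simpa using hhalf) hs hcoe h
    · exact not_isUnit_yElt hhalf h

end NextRing

/-! ### The stages and their union -/

instance isDomain_stage (n : ℕ) : IsDomain (stage n) := by
  induction n with
  | zero => exact inferInstanceAs (IsDomain (AddMonoidAlgebra (ZMod 2) ℚ≥0))
  | succ n ih => exact inferInstanceAs (IsDomain (nextRing (stage n)))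

lemma stageMap_self (n : ℕ) : stageMap n n le_rfl = RingHom.id (stage n) :=
  Nat.leRec_self _ _

lemma stageMap_succ {i j : ℕ} (h : i ≤ j) :
    stageMap i (j + 1) (h.trans j.le_succ) = (stageSucc j).comp (stageMap i j h) :=
  Nat.leRec_succ _ _ _

instance directedSystem_stage : DirectedSystem (fun n => stage n) (fun i j h => stageMap i j h) where
  map_self i x := by rw [stageMap_self]; rfl
  map_map := by
    intro k j i hij hjk x
    induction hjk with
    | refl => rw [stageMap_self]; rfl
    | step hjk ih =>
      rw [stageMap_succ hjk, stageMap_succ (hij.trans hjk), RingHom.comp_apply,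
        RingHom.comp_apply, ih]

lemma isDivisorClosed_stageMap {i j : ℕ} (h : i ≤ j) : IsDivisorClosed (stageMap i j h) := by
  induction h with
  | refl => rw [stageMap_self]; exact IsDivisorClosed.id
  | step h ih =>
    rw [stageMap_succ h]
    exact IsDivisorClosed.comp (isDivisorClosed_algebraMap_nextRing (R := stage _)) ih

/-- The inclusion of the `n`-th stage in `D`. -/
noncomputable abbrev toD (n : ℕ) : stage n →+* D :=
  Ring.DirectLimit.of (fun n => stage n) (fun i j h => stageMap i j h) n

lemma toD_stageMap {i j : ℕ} (h : i ≤ j) (a : stage i) : toD j (stageMap i j h a) = toD i a :=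
  Ring.DirectLimit.of_f (f := fun i j h => stageMap i j h) h a

lemma toD_stageSucc {n : ℕ} (a : stage n) : toD (n + 1) (stageSucc n a) = toD n a := by
  rw [← toD_stageMap n.le_succ a, stageMap_succ le_rfl, stageMap_self]
  rfl

lemma exists_toD_eq (x : D) : ∃ n a, toD n a = x :=
  Ring.DirectLimit.exists_of x

lemma isDivisorClosed_toD (n : ℕ) : IsDivisorClosed (toD n) where
  injective := Ring.DirectLimit.of_injective _
    (fun _ _ h => (isDivisorClosed_stageMap h).injective) n
  mem_range_of_dvd := by
    rintro c x hc ⟨y, hxy⟩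
    obtain ⟨i, a, rfl⟩ := exists_toD_eq x
    obtain ⟨j, b, rfl⟩ := exists_toD_eq y
    have hn : n ≤ n + i + j := by lia
    have hi : i ≤ n + i + j := by lia
    have hj : j ≤ n + i + j := by lia
    rw [← toD_stageMap hn, ← toD_stageMap hi, ← toD_stageMap hj, ← map_mul] at hxy
    have hxy := Ring.DirectLimit.of_injective _
      (fun _ _ h => (isDivisorClosed_stageMap h).injective) _ hxy
    obtain ⟨d, hd⟩ := (isDivisorClosed_stageMap hn).mem_range_of_dvd hc ⟨_, hxy⟩
    exact ⟨d, by rw [← toD_stageMap hn, hd, toD_stageMap]⟩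

instance isDomain_D : IsDomain D := by
  have : Nontrivial D := (isDivisorClosed_toD 0).injective.nontrivial
  have : NoZeroDivisors D := by
    refine ⟨fun {x y} hxy => ?_⟩
    obtain ⟨i, a, rfl⟩ := exists_toD_eq x
    obtain ⟨j, b, rfl⟩ := exists_toD_eq y
    have hi : i ≤ i + j := by lia
    have hj : j ≤ i + j := by lia
    rw [← toD_stageMap hi, ← toD_stageMap hj] at hxy ⊢
    rw [← map_mul, map_eq_zero_iff _ (isDivisorClosed_toD _).injective] at hxy
    exact (mul_eq_zero.1 hxy).imp (fun h => by rw [h, map_zero]) (fun h => by rw [h, map_zero])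
  exact NoZeroDivisors.to_isDomain D

lemma isAlmostAtomic_D : IsAlmostAtomic D := by
  intro α hα _
  obtain ⟨n, a, rfl⟩ := exists_toD_eq α
  have ha : a ≠ 0 := by rintro rfl; exact hα (map_zero _)
  by_cases hat : IsAtomicElement a
  · obtain ⟨s, hs, hirr, hprod⟩ := (isDivisorClosed_toD n).isAtomicElement_map hat
    exact ⟨s, hs, hirr, s + s, by simpa using hs, by simpa using hirr, by
      rw [Multiset.prod_add, hprod]⟩
  · obtain ⟨p, q, hp, hq, h⟩ := exists_isAtomicElement_mul_nextRing (R := stage n) ha hat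
    have hcl := isDivisorClosed_toD (n + 1)
    let p' : stage (n + 1) := p
    let q' : stage (n + 1) := q
    refine ⟨{toD (n + 1) p', toD (n + 1) q'}, by simp, ?_, ?_⟩
    · simpa using ⟨hcl.irreducible_map_iff.2 hp, hcl.irreducible_map_iff.2 hq⟩
    · have h := hcl.isAtomicElement_map (a := stageSucc n a * (p' * q')) h
      rwa [map_mul, map_mul, toD_stageSucc, ← Multiset.prod_pair] at h

lemma not_isSemiFurstenberg_D : ¬ IsSemiFurstenberg D := by
  rintro ⟨β, hβ⟩
  obtain ⟨n, b, rfl⟩ := exists_toD_eq β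
  have hcl := isDivisorClosed_toD (n + 1)
  let y : stage (n + 1) := (yElt 1 : nextRing (stage n))
  obtain ⟨π, hπ, hdvd, hndvd⟩ := hβ (toD (n + 1) y)
    ((map_ne_zero_iff _ hcl.injective).2 (yElt_ne_zero (R := stage n) 1))
    (fun h => not_isUnit_yElt (R := stage n) one_ne_zero (hcl.isUnit_map_iff.1 h))
  have hb : b ≠ 0 := by rintro rfl; exact hndvd (by rw [map_zero]; exact dvd_zero _)
  have hb' : stageSucc n b ≠ 0 := (map_ne_zero_iff _
    (isDivisorClosed_algebraMap_nextRing (R := stage n)).injective).2 hb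
  rw [← toD_stageSucc b, ← map_mul] at hdvd
  have hyb : y * stageSucc n b ≠ 0 := mul_ne_zero (yElt_ne_zero (R := stage n) 1) hb'
  obtain ⟨c, hc⟩ := hdvd
  obtain ⟨p, q, rfl, -, hpq⟩ := hcl.exists_of_mul_eq hyb hc.symm
  have hp : Irreducible p := hcl.irreducible_map_iff.1 hπ
  have hpy : p ∣ y * stageSucc n b := ⟨q, hpq.symm⟩
  have : p ∣ stageSucc n b := dvd_of_dvd_yElt_mul (R := stage n) (π := p) hb hp hpy
  obtain ⟨d, hd⟩ := this
  exact hndvd ⟨toD (n + 1) d, by rw [← toD_stageSucc b, hd, map_mul]⟩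

end SubatomicTower

theorem mainTheorem2 :
    IsDomain SubatomicTower.D ∧ SubatomicTower.IsAlmostAtomic SubatomicTower.D ∧
      ¬ SubatomicTower.IsSemiFurstenberg SubatomicTower.D :=
  ⟨SubatomicTower.isDomain_D, SubatomicTower.isAlmostAtomic_D,
    SubatomicTower.not_isSemiFurstenberg_D⟩
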